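/- Let $(T_t)_{t\ge 0}$ be a $C_0$-semigroup on a separable complex Banach space $X$, with infinitesimal generator $A$ on the domain $D(A)$. Assume that there is a family $(f_j)_{j\in\Gamma}$ of locally bounded measurable maps $f_j:I_j\to X$, where each $I_j\subset\mathbb{R}$ is an interval with more than one point, such that $f_j(I_j)\subset D(A)$, $Af_j(t)=itf_j(t)$ for all $t\in I_j$, $j\in\Gamma$, and $\mathrm{span}\{f_j(t): j\in\Gamma,\ t\in I_j\}$ is dense in $X$. Assume that either (a) $f_j\in C^2(I_j,X)$ for every $j\in\Gamma$, or (b) $X$ contains no closed subspace isomorphic to $c_0$, and $\langle\varphi,f_j\rangle\in C^1(I_j)$ for all $\varphi\in X'$ and $j\in\Gamma$. (Derivatives at endpoints belonging to $I_j$ are one-sided.) Then $(T_t)_{t\ge 0}$ has the specification property for semigroups (SgSP), that is: there exist an increasing sequence $(K_n)_{n\ge1}$ of subsets of $X$ with $T_t(K_n)\subset K_n$ for all $t\ge0$ and $n\ge 1$, $0\in K_1$ and $\overline{\bigcup_n K_n}=X$, and a number $t_0>0$, such that for every $n$ and every $\delta>0$ there is a real number $M=M_{\delta,n}>0$ with the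 following property. For every integer $s\ge 2$, all $y_1,\dots,y_s\in K_n$ and all real numbers $0=a_1\le b_1<a_2\le b_2<\dots<a_s\le b_s$ with $b_s+M\in\mathbb{N}\cdot t_0$ and $a_{r+1}-b_r\ge M$ for $r=1,\dots,s-1$, there is $x\in K_n$ with $\|T_{t}x-T_{t}y_r\|<\delta$ for all $t\in[a_r,b_r]$, $r=1,\dots,s$, and $T_{M+b_s}x=x$. -/

import Mathlib

open Filter Topology Set
open scoped NNReal ZeroAtInfty

/-- A `C₀`-semigroup of bounded linear operators on a complex normed space `X`. -/
structure C0Semigroup (X : Type*) [NormedAddCommGroup X] [NormedSpace ℂ X] where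
  /-- The operator `T_t`, for `t ≥ 0`. -/
  op : ℝ≥0 → X →L[ℂ] X
  op_zero : op 0 = ContinuousLinearMap.id ℂ X
  op_add : ∀ t s : ℝ≥0, op (t + s) = (op t).comp (op s)
  tendsto_op : ∀ (x : X) (s : ℝ≥0), Tendsto (fun t : ℝ≥0 => op t x) (𝓝 s) (𝓝 (op s x))

namespace C0Semigroup

variable {X : Type*} [NormedAddCommGroup X] [NormedSpace ℂ X]

/-- The difference quotient `(1 / t) (T_t x - x)` tends to `y` as `t → 0`, `t > 0`. -/
def HasGeneratorValue (T : C0Semigroup X) (x y : X) : Prop :=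
  Tendsto (fun t : ℝ≥0 => (((t : ℝ) : ℂ)⁻¹) • (T.op t x - x)) (𝓝[>] 0) (𝓝 y)

theorem HasGeneratorValue.unique {T : C0Semigroup X} {x y z : X}
    (hy : T.HasGeneratorValue x y) (hz : T.HasGeneratorValue x z) : y = z :=
  tendsto_nhds_unique hy hz

theorem HasGeneratorValue.add {T : C0Semigroup X} {x y x' y' : X}
    (h : T.HasGeneratorValue x y) (h' : T.HasGeneratorValue x' y') :
    T.HasGeneratorValue (x + x') (y + y') := by
  refine (Tendsto.add h h').congr fun t => ?_
  rw [map_add, ← smul_add, add_sub_add_comm]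

theorem HasGeneratorValue.smul {T : C0Semigroup X} {x y : X} (c : ℂ)
    (h : T.HasGeneratorValue x y) : T.HasGeneratorValue (c • x) (c • y) := by
  refine (Tendsto.const_smul h c).congr fun t => ?_
  rw [map_smul, ← smul_sub, smul_comm]

theorem hasGeneratorValue_zero (T : C0Semigroup X) : T.HasGeneratorValue 0 0 := by
  unfold HasGeneratorValue
  simp

/-- The infinitesimal generator `(A, D(A))`: `D(A)` is the set of all `x` for which
`A x = lim_{t → 0+} (1 / t) (T_t x - x)` exists. -/
noncomputable def generator (T : C0Semigroup X) : X →ₗ.[ℂ] X where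
  domain :=
    { carrier := {x | ∃ y, T.HasGeneratorValue x y}
      add_mem' := fun ⟨_, h⟩ ⟨_, h'⟩ => ⟨_, h.add h'⟩
      zero_mem' := ⟨0, T.hasGeneratorValue_zero⟩
      smul_mem' := fun c _ ⟨_, h⟩ => ⟨_, h.smul c⟩ }
  toFun :=
    { toFun := fun x => Classical.choose x.2
      map_add' := fun x x' => (Classical.choose_spec (x + x').2).unique
        ((Classical.choose_spec x.2).add (Classical.choose_spec x'.2))
      map_smul' := fun c x => (Classical.choose_spec (c • x).2).unique
        ((Classical.choose_spec x.2).smul c) }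

/-- The defining property of the generator. -/
theorem hasGeneratorValue_generator (T : C0Semigroup X) (x : T.generator.domain) :
    T.HasGeneratorValue x (T.generator x) :=
  Classical.choose_spec x.2

/-- The specification property for semigroups (SgSP). All times are nonnegative reals, and the
families `y`, `a`, `b` are only used at the indices `1, …, s`. -/
def HasSgSP (T : C0Semigroup X) : Prop :=
  ∃ K : ℕ → Set X,
    Monotone K ∧ (∀ (n : ℕ) (t : ℝ≥0), MapsTo (T.op t) (K n) (K n)) ∧
    0 ∈ K 0 ∧ closure (⋃ n, K n) = univ ∧
    ∃ t₀ : ℝ≥0, 0 < t₀ ∧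
      ∀ (n : ℕ) (δ : ℝ), 0 < δ → ∃ M : ℝ≥0, 0 < M ∧
        ∀ (s : ℕ), 2 ≤ s → ∀ (y : ℕ → X) (a b : ℕ → ℝ≥0),
          (∀ r ∈ Icc 1 s, y r ∈ K n) →
          a 1 = 0 →
          (∀ r ∈ Icc 1 s, a r ≤ b r) →
          (∀ r ∈ Ico 1 s, b r < a (r + 1)) →
          (∃ k : ℕ, b s + M = k * t₀) →
          (∀ r ∈ Ico 1 s, b r + M ≤ a (r + 1)) →
          ∃ x ∈ K n,
            (∀ r ∈ Icc 1 s, ∀ t ∈ Icc (a r) (b r), ‖T.op t x - T.op t (y r)‖ < δ) ∧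
            T.op (M + b s) x = x

end C0Semigroup

/-- `X` contains `c₀`: there is a linear homeomorphism of the space `c₀` of complex null
sequences with the supremum norm onto a subspace of `X`. -/
def ContainsC0 (X : Type*) [NormedAddCommGroup X] [NormedSpace ℂ X] : Prop :=
  ∃ L : C₀(ℕ, ℂ) →L[ℂ] X, ∃ c : ℝ, 0 < c ∧ ∀ u : C₀(ℕ, ℂ), c * ‖u‖ ≤ ‖L u‖

/-!
A smooth test function `φ` supported in the interior of `I j` produces the vector
`∫ φ s • f j s ds`. Since `T_t (f j s) = exp (I t s) f j s`, its orbit is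
`g t = ∫ exp (I t s) φ s • f j s ds`, a formula which also makes sense for `t < 0`: the semigroup acts
on the curve `g` by translation. By Hahn–Banach these vectors span a dense subspace
(`mem_of_integral_contDiff_smul_mem`).

The curve `g` is a Fourier transform. If `f j` is of class `C²`, two integrations by parts show that
`g` is integrable in norm. If `f j` is only weakly `C¹`, Plancherel's theorem and the Cauchy–Schwarz
inequality show that `ψ ∘ g` is integrable for every functional `ψ`, and the theorem of Bessaga and
Pełczyński (`containsC0_of_summable_dual`, proved through Rosenthal's disjointness lemma) turns this
into smallness of the tails of `∫ u • g`, uniformly over measurable densities `u` with `‖u‖ ≤ 1`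
(`HasUniformTails`). This uniform smallness is all that is used afterwards.

Separability gives a sequence of such curves `g i` whose values `g i 0` span a dense subspace. The
set `K n` consists of all superpositions `∑ i < n, ∫ u i t • g i t dt` with measurable densities
bounded by `n`. The semigroup translates the densities, so `K n` is invariant, and a vector whose
densities have period `P` is fixed by `T_P`. Specification therefore reduces to gluing densities
periodically (`exists_periodic_glue`, `C0Semigroup.exists_specification`): whenever two vectors have
densities that agree on a long window around `0`, they are close by the uniform tail estimate. The
period can be any number, so every `t₀ > 0` serves.
-/

open MeasureTheory FourierTransform

/-! ### Weakly unconditionally Cauchy series and `c₀` -/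

/-- Rosenthal's disjointness lemma for a nonnegative matrix with bounded row sums: along a suitable
infinite set of indices the off-diagonal row sums are at most `ε`. If none of the infinitely many
sets `{pair p q | q}` works, one bad row is chosen in each; the submatrix on the chosen rows has row
sums smaller by `ε`, and induction on the bound `n * ε` finishes. -/
theorem exists_injective_sum_offDiag_le {ε : ℝ} (hε : 0 ≤ ε) (n : ℕ) (a : ℕ → ℕ → ℝ)
    (ha : ∀ k j, 0 ≤ a k j) (hsum : ∀ k (F : Finset ℕ), ∑ j ∈ F, a k j ≤ n * ε) :
    ∃ σ : ℕ → ℕ, Function.Injective σ ∧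
      ∀ k (F : Finset ℕ), k ∉ F → ∑ j ∈ F, a (σ k) (σ j) ≤ ε := by
  induction n generalizing a with
  | zero =>
    refine ⟨id, Function.injective_id, fun k F _ => (hsum k F).trans ?_⟩
    simpa using hε
  | succ n ih =>
    by_cases hp : ∃ p : ℕ, ∀ q (F : Finset ℕ), q ∉ F →
        ∑ j ∈ F, a (Nat.pair p q) (Nat.pair p j) ≤ ε
    · obtain ⟨p, hp⟩ := hp
      exact ⟨Nat.pair p, fun x y h => (Nat.pair_eq_pair.1 h).2, hp⟩
    · push Not at hp
      choose q F hqF hF using hp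
      have hκ : Function.Injective fun p => Nat.pair p (q p) :=
        fun x y h => (Nat.pair_eq_pair.1 h).1
      obtain ⟨σ, hσ, h⟩ := ih (fun p p' => a (Nat.pair p (q p)) (Nat.pair p' (q p')))
        (fun _ _ => ha _ _) fun p G => by
          have hpair : Function.Injective (Nat.pair p) := fun x y h => (Nat.pair_eq_pair.1 h).2
          -- the chosen rows and the columns making row `pair p (q p)` bad do not meet
          have hdisj : Disjoint (G.image fun p => Nat.pair p (q p)) ((F p).image (Nat.pair p)) := by
            rw [Finset.disjoint_left]
            intro x hx hx'
            simp only [Finset.mem_image] at hx hx'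
            obtain ⟨p', -, rfl⟩ := hx
            obtain ⟨j, hj, hjp⟩ := hx'
            obtain ⟨rfl, rfl⟩ := Nat.pair_eq_pair.1 hjp
            exact hqF _ hj
          have h1 := hsum (Nat.pair p (q p))
            ((G.image fun p => Nat.pair p (q p)) ∪ ((F p).image (Nat.pair p)))
          rw [Finset.sum_union hdisj, Finset.sum_image fun _ _ _ _ h => hκ h,
            Finset.sum_image fun _ _ _ _ h => hpair h] at h1
          have h2 := hF p
          push_cast at h1
          linarith
      exact ⟨_, hκ.comp hσ, h⟩

section

variable {X : Type*} [NormedAddCommGroup X] [NormedSpace ℂ X]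

/-- For a weakly unconditionally Cauchy series `∑ y k`, the finite sums `∑ c k • y k` with
`‖c k‖ ≤ 1` are bounded: they are pointwise bounded as functionals on the dual space. -/
theorem exists_norm_sum_smul_le {y : ℕ → X}
    (hy : ∀ ψ : X →L[ℂ] ℂ, Summable fun k => ‖ψ (y k)‖) :
    ∃ C : ℝ, 0 ≤ C ∧ ∀ (F : Finset ℕ) (c : ℕ → ℂ) (R : ℝ), 0 ≤ R → (∀ k ∈ F, ‖c k‖ ≤ R) →
      ‖∑ k ∈ F, c k • y k‖ ≤ C * R := by
  let ι := Finset ℕ × {c : ℕ → ℂ // ∀ k, ‖c k‖ ≤ 1}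
  obtain ⟨C, hC⟩ := banach_steinhaus (𝕜 := ℂ) (𝕜₂ := ℂ) (E := StrongDual ℂ X) (F := ℂ)
    (g := fun p : ι => NormedSpace.inclusionInDoubleDual ℂ X (∑ k ∈ p.1, p.2.1 k • y k))
    (fun ψ => ⟨∑' k, ‖ψ (y k)‖, fun p => by
      rw [NormedSpace.dual_def, map_sum]
      refine (norm_sum_le _ _).trans (le_trans (Finset.sum_le_sum fun k _ => ?_)
        ((hy ψ).sum_le_tsum p.1 fun _ _ => norm_nonneg _))
      rw [map_smul, norm_smul]
      exact mul_le_of_le_one_left (norm_nonneg _) (p.2.2 k)⟩)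
  have hC0 : 0 ≤ C := (norm_nonneg _).trans (hC (∅, ⟨0, by simp⟩))
  refine ⟨C, hC0, fun F c R hR hc => ?_⟩
  rcases hR.eq_or_lt with rfl | hR
  · rw [Finset.sum_eq_zero fun k hk => ?_]
    · simp
    · rw [norm_le_zero_iff.1 (hc k hk), zero_smul]
  · have h := hC (F, ⟨fun k => if k ∈ F then (R⁻¹ : ℂ) * c k else 0, fun k => by
      dsimp only
      split_ifs with hk
      · rw [norm_mul, norm_inv, Complex.norm_real, Real.norm_of_nonneg hR.le, inv_mul_le_one₀ hR]
        exact hc k hk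
      · simp⟩)
    change ‖NormedSpace.inclusionInDoubleDualLi ℂ (E := X) _‖ ≤ C at h
    rw [LinearIsometry.norm_map] at h
    have h' : ∑ k ∈ F, (if k ∈ F then (R⁻¹ : ℂ) * c k else 0) • y k
        = (R⁻¹ : ℂ) • ∑ k ∈ F, c k • y k := by
      rw [Finset.smul_sum]
      refine Finset.sum_congr rfl fun k hk => ?_
      rw [if_pos hk, mul_smul]
    simp only [] at h
    rw [h', norm_smul, norm_inv, Complex.norm_real, Real.norm_of_nonneg hR.le,
      inv_mul_le_iff₀ hR] at h
    linarith

/-- A form of the Bessaga–Pełczyński theorem: if `∑ y k` is weakly unconditionally Cauchy but its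
terms stay away from `0`, then `X` contains `c₀`. The embedding sends the unit vectors of `c₀` to a
subfamily of `y` on which norming functionals of the terms are almost biorthogonal. -/
theorem containsC0_of_summable_dual [CompleteSpace X] {y : ℕ → X} {ε : ℝ} (hε : 0 < ε)
    (hy : ∀ ψ : X →L[ℂ] ℂ, Summable fun k => ‖ψ (y k)‖) (hyε : ∀ k, ε ≤ ‖y k‖) :
    ContainsC0 X := by
  obtain ⟨C, hC0, hC⟩ := exists_norm_sum_smul_le hy
  choose φ hφ1 hφ using fun k => exists_dual_vector'' ℂ (y k)
  have hrow : ∀ k (F : Finset ℕ), ∑ j ∈ F, ‖φ k (y j)‖ ≤ C := by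
    intro k F
    -- unimodular multiples of the `y j` make the values `φ k (y j)` nonnegative
    choose c hc1 hc using fun j => RCLike.exists_norm_eq_mul_self (φ k (y j))
    have h := hC F c 1 zero_le_one fun j _ => (hc1 j).le
    have h2 : φ k (∑ j ∈ F, c j • y j) = ((∑ j ∈ F, ‖φ k (y j)‖ : ℝ) : ℂ) := by
      rw [map_sum]
      push_cast
      refine Finset.sum_congr rfl fun j _ => ?_
      rw [map_smul, smul_eq_mul, ← hc j]
      rfl
    have h3 := (φ k).le_of_opNorm_le (hφ1 k) (∑ j ∈ F, c j • y j)
    rw [h2, Complex.norm_real, one_mul] at h3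
    linarith [Real.le_norm_self (∑ j ∈ F, ‖φ k (y j)‖)]
  obtain ⟨n, hn⟩ := exists_nat_ge (C / (ε / 2))
  obtain ⟨σ, hσ, hoff⟩ := exists_injective_sum_offDiag_le (half_pos hε).le n
    (fun k j => ‖φ k (y j)‖) (fun _ _ => norm_nonneg _)
    fun k F => (hrow k F).trans ((div_le_iff₀ (half_pos hε)).1 hn)
  have hCσ : ∀ (F : Finset ℕ) (c : ℕ → ℂ) (R : ℝ), 0 ≤ R → (∀ k ∈ F, ‖c k‖ ≤ R) →
      ‖∑ k ∈ F, c k • y (σ k)‖ ≤ C * R := by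
    intro F c R hR hc
    have h := hC (F.image σ) (fun j => c (Function.invFun σ j)) R hR (by
      simp only [Finset.mem_image]
      rintro _ ⟨k, hk, rfl⟩
      rw [Function.leftInverse_invFun hσ k]
      exact hc k hk)
    rw [Finset.sum_image fun _ _ _ _ h => hσ h] at h
    simpa only [Function.leftInverse_invFun hσ _] using h
  have hnorm : ∀ (u : C₀(ℕ, ℂ)) k, ‖u k‖ ≤ ‖u‖ := fun u k => by
    rw [← ZeroAtInftyContinuousMap.norm_toBCF_eq_norm]
    exact u.toBCF.norm_coe_le_norm k
  have hsummable : ∀ u : C₀(ℕ, ℂ), Summable fun k => u k • y (σ k) := by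
    intro u
    rw [summable_iff_vanishing_norm]
    intro η hη
    have hu : Tendsto u cofinite (𝓝 0) := by
      have h := u.zero_at_infty'
      rwa [cocompact_eq_cofinite] at h
    have hfin : {k | ¬ ‖u k‖ < η / (C + 1)}.Finite := by
      have := (tendsto_zero_iff_norm_tendsto_zero.1 hu).eventually_lt_const
        (show 0 < η / (C + 1) by positivity)
      simpa using this
    refine ⟨hfin.toFinset, fun F hF => ?_⟩
    refine (hCσ F u (η / (C + 1)) (by positivity) fun k hk => ?_).trans_lt ?_
    · by_contra h
      exact Finset.disjoint_left.1 hF hk (hfin.mem_toFinset.2 fun h' => h h'.le)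
    · rw [mul_div_assoc', div_lt_iff₀ (by positivity)]
      nlinarith
  let L : C₀(ℕ, ℂ) →ₗ[ℂ] X :=
    { toFun := fun u => ∑' k, u k • y (σ k)
      map_add' := fun u v => by
        rw [← (hsummable u).tsum_add (hsummable v)]
        exact tsum_congr fun k => by rw [← add_smul]; rfl
      map_smul' := fun c u => by
        rw [RingHom.id_apply, ← (hsummable u).tsum_const_smul]
        exact tsum_congr fun k => by rw [smul_smul]; rfl }
  have hLbound : ∀ u, ‖L u‖ ≤ C * ‖u‖ := fun u =>
    le_of_tendsto ((hsummable u).hasSum.norm) (Eventually.of_forall fun F =>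
      hCσ F u ‖u‖ (norm_nonneg _) fun k _ => hnorm u k)
  refine ⟨L.mkContinuous C hLbound, ε / 2, half_pos hε, fun u => ?_⟩
  rw [LinearMap.mkContinuous_apply]
  have key : ∀ k, ε * ‖u k‖ ≤ ‖L u‖ + ε / 2 * ‖u‖ := by
    intro k
    -- split the series for `φ (σ k) (L u)` into its diagonal term and the rest
    have hs : HasSum (fun j => u j * φ (σ k) (y (σ j))) (φ (σ k) (L u)) := by
      have h := (hsummable u).hasSum.mapL (φ (σ k))
      simp only [map_smul, smul_eq_mul] at h
      exact h
    have hrest : ‖φ (σ k) (L u) - u k * φ (σ k) (y (σ k))‖ ≤ ε / 2 * ‖u‖ := by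
      have hs' : Tendsto (fun F : Finset ℕ => ∑ j ∈ F, u j * φ (σ k) (y (σ j))) atTop
        (𝓝 (φ (σ k) (L u))) := hs
      refine le_of_tendsto (hs'.sub_const _).norm ?_
      filter_upwards [eventually_ge_atTop {k}] with F hF
      have hkF : k ∈ F := hF (Finset.mem_singleton_self k)
      rw [← Finset.add_sum_erase F _ hkF, add_sub_cancel_left]
      calc ‖∑ j ∈ F.erase k, u j * φ (σ k) (y (σ j))‖
          ≤ ∑ j ∈ F.erase k, ‖u‖ * ‖φ (σ k) (y (σ j))‖ :=
            norm_sum_le_of_le _ fun j _ => by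
              rw [norm_mul]
              exact mul_le_mul_of_nonneg_right (hnorm u j) (norm_nonneg _)
        _ ≤ ε / 2 * ‖u‖ := by
            rw [← Finset.mul_sum, mul_comm]
            exact mul_le_mul_of_nonneg_right (hoff k _ (Finset.notMem_erase k F)) (norm_nonneg _)
    have h1 : ‖u k * φ (σ k) (y (σ k))‖ = ‖u k‖ * ‖y (σ k)‖ := by
      rw [norm_mul, hφ]; simp
    have h2 : ‖u k * φ (σ k) (y (σ k))‖ ≤ ‖φ (σ k) (L u)‖ + ε / 2 * ‖u‖ := by
      have := norm_sub_norm_le (u k * φ (σ k) (y (σ k))) (φ (σ k) (L u))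
      rw [norm_sub_rev] at this
      linarith
    have h3 := (φ (σ k)).le_of_opNorm_le (hφ1 (σ k)) (L u)
    have h4 := mul_le_mul_of_nonneg_left (hyε (σ k)) (norm_nonneg (u k))
    linarith
  have hu : ‖u‖ ≤ (‖L u‖ + ε / 2 * ‖u‖) / ε := by
    rw [← ZeroAtInftyContinuousMap.norm_toBCF_eq_norm]
    refine (BoundedContinuousFunction.norm_le (by positivity)).2 fun k => ?_
    rw [le_div_iff₀ hε, ZeroAtInftyContinuousMap.norm_toBCF_eq_norm, mul_comm]
    exact key k
  rw [le_div_iff₀ hε] at hu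
  linarith

end

/-! ### Integrability of Fourier transforms -/

/-- Plancherel for an integrable, square integrable function: its Fourier integral agrees a.e. with
the `L²` Fourier transform, since both define the same distribution. -/
theorem memLp_two_fourier {f : ℝ → ℂ} (hf : Integrable f) (hf2 : MemLp f 2) :
    MemLp (𝓕 f) 2 := by
  set g : Lp ℂ 2 (volume : Measure ℝ) := hf2.toLp f with hg
  have hcont : Continuous (𝓕 f) :=
    VectorFourier.fourierIntegral_continuous Real.continuous_fourierChar
      (by exact continuous_inner) hf
  refine (Lp.memLp (𝓕 g)).ae_eq ?_
  refine ae_eq_of_integral_contDiff_smul_eq ((Lp.memLp (𝓕 g)).locallyIntegrable (by norm_num))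
    hcont.locallyIntegrable fun φ hφ hφc => ?_
  have hφ₁ : HasCompactSupport (Complex.ofRealCLM ∘ φ) := hφc.comp_left rfl
  have hφ₂ : ContDiff ℝ ((⊤ : ℕ∞) : WithTop ℕ∞) (Complex.ofRealCLM ∘ φ) := by fun_prop
  set Φ := hφ₁.toSchwartzMap hφ₂
  have h1 := DFunLike.congr_fun (Lp.fourier_toTemperedDistribution_eq g) Φ
  rw [TemperedDistribution.fourier_apply, Lp.toTemperedDistribution_apply,
    Lp.toTemperedDistribution_apply] at h1
  have h2 : ∫ x, (𝓕 Φ) x • g x = ∫ x, (𝓕 (Φ : ℝ → ℂ)) x • f x := by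
    refine integral_congr_ae ?_
    filter_upwards [hf2.coeFn_toLp] with x hx
    rw [hg, hx, SchwartzMap.fourier_coe]
  have h3 : ∫ x, (𝓕 (Φ : ℝ → ℂ)) x • f x = ∫ x, Φ x • (𝓕 f) x := by
    have := VectorFourier.integral_fourierIntegral_smul_eq_flip (L := innerₗ ℝ)
      Real.continuous_fourierChar continuous_inner (Φ.integrable (μ := volume)) hf
    rw [flip_innerₗ] at this
    exact this
  calc ∫ x, φ x • (𝓕 g) x = ∫ x, Φ x • (𝓕 g) x := by simp [Φ]
    _ = ∫ x, Φ x • (𝓕 f) x := by rw [← h1, h2, h3]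
    _ = ∫ x, φ x • (𝓕 f) x := by simp [Φ]

/-- Both `𝓕 F` and `x ↦ x * 𝓕 F x` are square integrable by Plancherel, and
`(1 + 2 * π * I * x)⁻¹` is square integrable, so `𝓕 F` is integrable by Cauchy–Schwarz. -/
theorem integrable_fourier_of_contDiff_one {F : ℝ → ℂ} (hF : ContDiff ℝ 1 F)
    (hc : HasCompactSupport F) : Integrable (𝓕 F) := by
  have hd : Continuous (deriv F) := hF.continuous_deriv le_rfl
  have hFi : Integrable F := hF.continuous.integrable_of_hasCompactSupport hc
  have hdi : Integrable (deriv F) := hd.integrable_of_hasCompactSupport hc.deriv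
  have h1 := memLp_two_fourier hFi (hF.continuous.memLp_of_hasCompactSupport hc)
  have h2 := memLp_two_fourier hdi (hd.memLp_of_hasCompactSupport hc.deriv)
  rw [Real.fourier_deriv hFi (hF.differentiable one_ne_zero) hdi] at h2
  have hw : MemLp (fun x : ℝ => ((1 + 2 * Real.pi * Complex.I * x)⁻¹ : ℂ)) 2 := by
    have hne : ∀ x : ℝ, (1 + 2 * Real.pi * Complex.I * x : ℂ) ≠ 0 := fun x h => by
      have := congrArg Complex.re h
      simp at this
    have hwc : Continuous fun x : ℝ => ((1 + 2 * Real.pi * Complex.I * x)⁻¹ : ℂ) :=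
      Continuous.inv₀ (by fun_prop) hne
    rw [memLp_two_iff_integrable_sq_norm hwc.aestronglyMeasurable]
    refine integrable_inv_one_add_sq.mono' (hwc.norm.pow 2).aestronglyMeasurable
      (Eventually.of_forall fun x => ?_)
    rw [norm_pow, norm_norm, norm_inv, inv_pow, Complex.sq_norm]
    refine inv_anti₀ (by positivity) ?_
    simp only [Complex.normSq_apply, Complex.add_re, Complex.add_im, Complex.mul_re, Complex.mul_im,
      Complex.I_re, Complex.I_im, Complex.ofReal_re, Complex.ofReal_im, Complex.one_re,
      Complex.one_im, Complex.re_ofNat, Complex.im_ofNat]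
    nlinarith [Real.pi_gt_three, sq_nonneg x,
      mul_nonneg (sq_nonneg x) (sub_nonneg.2 Real.pi_gt_three.le)]
  have h3 := hw.integrable_mul (h1.add h2)
  refine h3.congr (Eventually.of_forall fun x => ?_)
  have hne : (1 + 2 * Real.pi * Complex.I * x : ℂ) ≠ 0 := fun h => by
    have := congrArg Complex.re h
    simp at this
  simp only [Pi.mul_apply, Pi.add_apply, smul_eq_mul]
  field_simp

/-- In a general Banach space Plancherel is not available; two integrations by parts give the decay
`‖𝓕 F x‖ = O (1 / (1 + x ^ 2))`. -/
theorem integrable_fourier_of_contDiff_two {X : Type*} [NormedAddCommGroup X] [NormedSpace ℂ X]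
    {F : ℝ → X} (hF : ContDiff ℝ 2 F) (hc : HasCompactSupport F) : Integrable (𝓕 F) := by
  have hFi : Integrable F := hF.continuous.integrable_of_hasCompactSupport hc
  have hd : ContDiff ℝ 1 (deriv F) :=
    ContDiff.deriv' (n := 1) (by simpa [one_add_one_eq_two] using hF)
  have hdi : Integrable (deriv F) := hd.continuous.integrable_of_hasCompactSupport hc.deriv
  have hd2i : Integrable (deriv (deriv F)) :=
    (hd.continuous_deriv le_rfl).integrable_of_hasCompactSupport hc.deriv.deriv
  have hcont : Continuous (𝓕 F) :=
    VectorFourier.fourierIntegral_continuous Real.continuous_fourierChar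
      (by exact continuous_inner) hFi
  have h2 : ∀ x : ℝ, (2 * Real.pi * x) ^ 2 * ‖𝓕 F x‖ ≤ ∫ v, ‖deriv (deriv F) v‖ := by
    intro x
    have := VectorFourier.norm_fourierIntegral_le_integral_norm Real.fourierChar volume (innerₗ ℝ)
      (deriv (deriv F)) x
    change ‖𝓕 (deriv (deriv F)) x‖ ≤ _ at this
    rw [Real.fourier_deriv hdi (hd.differentiable one_ne_zero) hd2i,
      Real.fourier_deriv hFi (hF.differentiable two_ne_zero) hdi] at this
    simp only [norm_smul, norm_mul, Complex.norm_ofNat, Complex.norm_real, Complex.norm_I,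
      Real.norm_eq_abs, mul_one] at this
    rw [mul_pow, mul_pow, ← sq_abs x, ← sq_abs Real.pi]
    linarith
  have h0 : ∀ x : ℝ, ‖𝓕 F x‖ ≤ ∫ v, ‖F v‖ := fun x =>
    VectorFourier.norm_fourierIntegral_le_integral_norm Real.fourierChar volume (innerₗ ℝ) F x
  refine (integrable_inv_one_add_sq.const_mul
    ((∫ v, ‖F v‖) + ∫ v, ‖deriv (deriv F) v‖)).mono' hcont.aestronglyMeasurable
    (Eventually.of_forall fun x => ?_)
  rw [← div_eq_mul_inv, le_div_iff₀ (by positivity)]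
  have hpi : x ^ 2 ≤ (2 * Real.pi * x) ^ 2 := by
    rw [mul_pow]
    exact le_mul_of_one_le_left (sq_nonneg x) (by nlinarith [Real.pi_gt_three])
  have := mul_le_mul_of_nonneg_right hpi (norm_nonneg (𝓕 F x))
  linarith [h2 x, h0 x]

/-! ### Uniformly small tails -/

section

variable {X : Type*} [NormedAddCommGroup X] [NormedSpace ℂ X]

/-- The integrals `∫ u • g` of `g` against measurable densities `‖u‖ ≤ 1` have uniformly small tails.
This plays the role of Pettis integrability of `g` on `ℝ`: it makes the improper integrals
`∫ u • g` converge for every bounded measurable `u`, with a rate depending only on the bound. -/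
def HasUniformTails (g : ℝ → X) : Prop :=
  ∀ ε : ℝ, 0 < ε → ∃ N : ℝ, 0 < N ∧ ∀ (u : ℝ → ℂ) (A B : ℝ), Measurable u → (∀ t, ‖u t‖ ≤ 1) →
    A ≤ B → (N ≤ A ∨ B ≤ -N) → ‖∫ t in A..B, u t • g t‖ ≤ ε

theorem Continuous.intervalIntegrable_bounded_smul {g : ℝ → X} (hg : Continuous g) {u : ℝ → ℂ}
    (hu : Measurable u) {C : ℝ} (hC : ∀ t, ‖u t‖ ≤ C) (A B : ℝ) :
    IntervalIntegrable (fun t => u t • g t) volume A B := by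
  have h := hg.intervalIntegrable (μ := volume) A B
  exact ⟨h.1.bdd_smul C hu.aestronglyMeasurable (Eventually.of_forall hC),
    h.2.bdd_smul C hu.aestronglyMeasurable (Eventually.of_forall hC)⟩

theorem HasUniformTails.of_integrable {g : ℝ → X} (hgc : Continuous g) (hg : Integrable g) :
    HasUniformTails g := by
  intro ε hε
  have h := intervalIntegral_tendsto_integral hg.norm tendsto_neg_atTop_atBot tendsto_id
  obtain ⟨N, hN, hN0⟩ := ((h.eventually_const_lt (sub_lt_self _ hε)).and
    (eventually_gt_atTop 0)).exists
  refine ⟨N, hN0, fun u A B hu hu1 hAB hN' => ?_⟩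
  have h1 : ‖∫ t in A..B, u t • g t‖ ≤ ∫ t in Ioc A B, ‖g t‖ := by
    rw [intervalIntegral.integral_of_le hAB]
    refine (norm_integral_le_integral_norm _).trans
      (integral_mono ?_ hg.norm.integrableOn fun t => ?_)
    · exact (hgc.intervalIntegrable_bounded_smul hu hu1 A B).1.norm
    · dsimp only
      rw [norm_smul]
      exact mul_le_of_le_one_left (norm_nonneg _) (hu1 t)
  have hdisj : Disjoint (Ioc (-N) N) (Ioc A B) := by
    rw [Set.disjoint_left]
    rintro t ⟨h1, h2⟩ ⟨h3, h4⟩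
    rcases hN' with h | h <;> linarith
  have h2 : (∫ t in Ioc (-N) N, ‖g t‖) + ∫ t in Ioc A B, ‖g t‖ ≤ ∫ t, ‖g t‖ := by
    rw [← setIntegral_union hdisj measurableSet_Ioc hg.norm.integrableOn hg.norm.integrableOn]
    exact setIntegral_le_integral hg.norm (Eventually.of_forall fun t => norm_nonneg _)
  simp only [id, intervalIntegral.integral_of_le (neg_le_self hN0.le)] at hN
  linarith

/-- If the tails were not uniformly small, integrals over successive disjoint intervals would form a
weakly unconditionally Cauchy series whose terms stay away from `0`, and `X` would contain `c₀`. -/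
theorem HasUniformTails.of_dual_integrable [CompleteSpace X] (hX : ¬ ContainsC0 X) {g : ℝ → X}
    (hgc : Continuous g) (hg : ∀ ψ : X →L[ℂ] ℂ, Integrable fun t => ψ (g t)) :
    HasUniformTails g := by
  intro ε hε
  by_contra! hcon
  have hcon' : ∀ N : ℝ, ∃ (u : ℝ → ℂ) (A B : ℝ), 0 < N → Measurable u ∧ (∀ t, ‖u t‖ ≤ 1) ∧
      A ≤ B ∧ (N ≤ A ∨ B ≤ -N) ∧ ε < ‖∫ t in A..B, u t • g t‖ := by
    intro N
    by_cases hN : 0 < N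
    · obtain ⟨u, A, B, h⟩ := hcon N hN
      exact ⟨u, A, B, fun _ => h⟩
    · exact ⟨0, 0, 0, fun h => absurd h hN⟩
  choose u A B h using hcon'
  -- the `k`-th interval `(A (N k), B (N k)]` lies in the shell `N k ≤ |t| < N (k + 1)`
  let N : ℕ → ℝ := fun k => Nat.rec 1 (fun _ x => x + |A x| + |B x| + 1) k
  have hNs : ∀ k, N (k + 1) = N k + |A (N k)| + |B (N k)| + 1 := fun _ => rfl
  have hNmono : Monotone N := monotone_nat_of_le_succ fun k => by
    rw [hNs]; linarith [abs_nonneg (A (N k)), abs_nonneg (B (N k))]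
  have hN0 : ∀ k, 0 < N k := fun k => zero_lt_one.trans_le (hNmono (Nat.zero_le k))
  have hshell : ∀ k, ∀ t ∈ Ioc (A (N k)) (B (N k)), N k ≤ |t| ∧ |t| < N (k + 1) := by
    rintro k t ⟨ht1, ht2⟩
    obtain ⟨-, -, -, h4, -⟩ := h (N k) (hN0 k)
    constructor
    · rcases h4 with h4 | h4
      · exact (h4.trans ht1.le).trans (le_abs_self t)
      · exact le_trans (by linarith) (neg_le_abs t)
    · rw [hNs, abs_lt]
      constructor <;> linarith [abs_nonneg (A (N k)), abs_nonneg (B (N k)), neg_abs_le (A (N k)),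
        le_abs_self (B (N k)), hN0 k]
  have hdisj : Pairwise (Function.onFun Disjoint fun k => Ioc (A (N k)) (B (N k))) := by
    refine (pairwise_disjoint_on _).2 fun k l hkl => ?_
    rw [Set.disjoint_left]
    intro t hk hl
    have := hNmono (Nat.succ_le_of_lt hkl)
    linarith [(hshell k t hk).2, (hshell l t hl).1]
  refine hX (containsC0_of_summable_dual
    (y := fun k => ∫ t in (A (N k))..(B (N k)), u (N k) t • g t) hε (fun ψ => ?_)
    fun k => (h (N k) (hN0 k)).2.2.2.2.le)
  have hsum := (hasSum_integral_iUnion (fun k => measurableSet_Ioc) hdisj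
    (hg ψ).norm.integrableOn).summable
  refine hsum.of_nonneg_of_le (fun _ => norm_nonneg _) fun k => ?_
  obtain ⟨hu, hu1, hAB, -, -⟩ := h (N k) (hN0 k)
  have hint := hgc.intervalIntegrable_bounded_smul hu hu1 (A (N k)) (B (N k))
  rw [intervalIntegral.integral_of_le hAB, ← ψ.integral_comp_comm hint.1]
  refine (norm_integral_le_integral_norm _).trans
    (integral_mono (ψ.integrable_comp hint.1).norm (hg ψ).norm.integrableOn fun t => ?_)
  dsimp only
  rw [map_smul, norm_smul]
  exact mul_le_of_le_one_left (norm_nonneg _) (hu1 t)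

end

/-! ### Superpositions of curves -/

section

variable {X : Type*} [NormedAddCommGroup X] [NormedSpace ℂ X]

/-- `y` is the improper integral `∑ i < n, ∫ t, u i t • g i t` over the real line, the two limits of
integration tending to `-∞` and `∞` independently. -/
def IsSuperposition (g : ℕ → ℝ → X) (n : ℕ) (u : ℕ → ℝ → ℂ) (y : X) : Prop :=
  Tendsto (fun p : ℝ × ℝ => ∫ t in p.1..p.2, ∑ i ∈ Finset.range n, u i t • g i t)
    (atBot ×ˢ atTop) (𝓝 y)

theorem intervalIntegrable_sum_bounded_smul {g : ℕ → ℝ → X} (hg : ∀ i, Continuous (g i))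
    {u : ℕ → ℝ → ℂ} (hu : ∀ i, Measurable (u i)) {C : ℝ} (hC : ∀ i t, ‖u i t‖ ≤ C) (n : ℕ)
    (A B : ℝ) :
    IntervalIntegrable (fun t => ∑ i ∈ Finset.range n, u i t • g i t) volume A B := by
  have h : (fun t => ∑ i ∈ Finset.range n, u i t • g i t)
      = ∑ i ∈ Finset.range n, fun t => u i t • g i t := by
    funext t
    rw [Finset.sum_apply]
  rw [h]
  exact IntervalIntegrable.sum _
    fun i _ => (hg i).intervalIntegrable_bounded_smul (hu i) (hC i) A B

theorem HasUniformTails.exists_norm_integral_sum_le {g : ℕ → ℝ → X} (hgc : ∀ i, Continuous (g i))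
    (hg : ∀ i, HasUniformTails (g i)) (n : ℕ) {C ε : ℝ} (hC : 0 ≤ C) (hε : 0 < ε) :
    ∃ N : ℝ, 0 < N ∧ ∀ (u : ℕ → ℝ → ℂ) (A B : ℝ), (∀ i, Measurable (u i)) →
      (∀ i t, ‖u i t‖ ≤ C) → (N ≤ A ∧ N ≤ B ∨ A ≤ -N ∧ B ≤ -N) →
      ‖∫ t in A..B, ∑ i ∈ Finset.range n, u i t • g i t‖ ≤ ε := by
  have hη : 0 < ε / ((n + 1) * (C + 1)) := by positivity
  choose N hN0 hN using fun i => hg i _ hη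
  have hNle : ∀ i ∈ Finset.range n, N i ≤ 1 + ∑ i ∈ Finset.range n, N i := fun i hi => by
    linarith [Finset.single_le_sum (f := N) (fun i _ => (hN0 i).le) hi]
  refine ⟨1 + ∑ i ∈ Finset.range n, N i,
    add_pos_of_pos_of_nonneg one_pos (Finset.sum_nonneg fun i _ => (hN0 i).le),
    fun u A B hu huC hAB => ?_⟩
  wlog hle : A ≤ B generalizing A B
  · rw [intervalIntegral.integral_symm, norm_neg]
    exact this B A (hAB.imp And.symm And.symm) (le_of_not_ge hle)
  have hterm : ∀ i ∈ Finset.range n, ‖∫ t in A..B, u i t • g i t‖ ≤ ε / (n + 1) := by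
    intro i hi
    have h := hN i (fun t => ((C + 1 : ℝ) : ℂ)⁻¹ * u i t) A B ((hu i).const_mul _) (fun t => by
      rw [norm_mul, norm_inv, Complex.norm_real, Real.norm_of_nonneg (by positivity),
        inv_mul_le_one₀ (by positivity)]
      linarith [huC i t]) hle (by
        have := hNle i hi
        rcases hAB with h | h
        · exact Or.inl (by linarith [h.1])
        · exact Or.inr (by linarith [h.2]))
    simp only [mul_smul] at h
    rw [intervalIntegral.integral_smul, norm_smul, norm_inv, Complex.norm_real,
      Real.norm_of_nonneg (by positivity), inv_mul_le_iff₀ (by positivity)] at h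
    refine h.trans (le_of_eq ?_)
    field_simp
  rw [intervalIntegral.integral_finsetSum fun i _ =>
    (hgc i).intervalIntegrable_bounded_smul (hu i) (huC i) A B]
  refine (norm_sum_le_of_le _ hterm).trans ?_
  rw [Finset.sum_const, Finset.card_range, nsmul_eq_mul, mul_div_assoc',
    div_le_iff₀ (by positivity)]
  nlinarith

theorem exists_isSuperposition [CompleteSpace X] {g : ℕ → ℝ → X} (hgc : ∀ i, Continuous (g i))
    (hg : ∀ i, HasUniformTails (g i)) (n : ℕ) {u : ℕ → ℝ → ℂ} (hu : ∀ i, Measurable (u i))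
    {C : ℝ} (hC : ∀ i t, ‖u i t‖ ≤ C) : ∃ y, IsSuperposition g n u y := by
  refine cauchy_map_iff_exists_tendsto.1 ?_
  rw [Metric.cauchy_iff]
  refine ⟨inferInstance, fun ε hε => ?_⟩
  obtain ⟨N, -, hN⟩ := HasUniformTails.exists_norm_integral_sum_le hgc hg n
    ((norm_nonneg _).trans (hC 0 0)) (show 0 < ε / 3 by positivity)
  refine ⟨_, image_mem_map (prod_mem_prod (Iic_mem_atBot (-N)) (Ici_mem_atTop N)), ?_⟩
  rintro _ ⟨p, hp, rfl⟩ _ ⟨q, hq, rfl⟩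
  have hint := intervalIntegrable_sum_bounded_smul hgc hu hC n
  rw [dist_eq_norm, intervalIntegral.integral_interval_sub_interval_comm (hint _ _) (hint _ _)
    (hint _ _)]
  have h1 := hN u p.1 q.1 hu hC (Or.inr ⟨hp.1, hq.1⟩)
  have h2 := hN u p.2 q.2 hu hC (Or.inl ⟨hp.2, hq.2⟩)
  exact (norm_sub_le _ _).trans_lt (by linarith)

theorem IsSuperposition.sub {g : ℕ → ℝ → X} (hgc : ∀ i, Continuous (g i)) {n : ℕ}
    {u v : ℕ → ℝ → ℂ} {x y : X} (hu : ∀ i, Measurable (u i)) (hv : ∀ i, Measurable (v i))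
    {C : ℝ} (huC : ∀ i t, ‖u i t‖ ≤ C) (hvC : ∀ i t, ‖v i t‖ ≤ C)
    (hx : IsSuperposition g n u x) (hy : IsSuperposition g n v y) :
    IsSuperposition g n (fun i t => u i t - v i t) (x - y) := by
  refine (Tendsto.sub hx hy).congr fun p => ?_
  rw [← intervalIntegral.integral_sub (intervalIntegrable_sum_bounded_smul hgc hu huC n _ _)
    (intervalIntegrable_sum_bounded_smul hgc hv hvC n _ _)]
  simp only [← Finset.sum_sub_distrib, sub_smul]

/-- If the densities vanish on `(-N, N]`, only the two tails contribute to the superposition. -/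
theorem IsSuperposition.norm_le {g : ℕ → ℝ → X} (hgc : ∀ i, Continuous (g i)) {n : ℕ}
    {u : ℕ → ℝ → ℂ} {y : X} (hy : IsSuperposition g n u y) (hu : ∀ i, Measurable (u i))
    {C : ℝ} (hC : ∀ i t, ‖u i t‖ ≤ C) {N ε : ℝ} (hN0 : 0 < N)
    (hN : ∀ A B : ℝ, (N ≤ A ∧ N ≤ B ∨ A ≤ -N ∧ B ≤ -N) →
      ‖∫ t in A..B, ∑ i ∈ Finset.range n, u i t • g i t‖ ≤ ε)
    (hzero : ∀ i, ∀ t ∈ Ioc (-N) N, u i t = 0) : ‖y‖ ≤ 2 * ε := by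
  have hint := intervalIntegrable_sum_bounded_smul hgc hu hC n
  refine le_of_tendsto (Tendsto.norm hy) ?_
  filter_upwards [prod_mem_prod (Iic_mem_atBot (-N)) (Ici_mem_atTop N)] with p hp
  have hmid : ∫ t in (-N)..N, ∑ i ∈ Finset.range n, u i t • g i t = 0 := by
    rw [intervalIntegral.integral_of_le (neg_le_self hN0.le)]
    refine setIntegral_eq_zero_of_forall_eq_zero fun t ht => Finset.sum_eq_zero fun i _ => ?_
    rw [hzero i t ht, zero_smul]
  rw [← intervalIntegral.integral_add_adjacent_intervals (hint p.1 N) (hint N p.2),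
    ← intervalIntegral.integral_add_adjacent_intervals (hint p.1 (-N)) (hint (-N) N),
    hmid, add_zero]
  have h1 := hN p.1 (-N) (Or.inr ⟨hp.1, le_rfl⟩)
  have h2 := hN N p.2 (Or.inl ⟨le_rfl, hp.2⟩)
  exact (norm_add_le _ _).trans (by linarith)

namespace C0Semigroup

/-- A continuous curve `g : ℝ → X` on which the semigroup acts by translation, so that `g` extends the
orbit of `g 0` to negative times, and whose tails are uniformly small. -/
structure IsBilateralOrbit (T : C0Semigroup X) (g : ℝ → X) : Prop where
  continuous : Continuous g
  map_op : ∀ (r : ℝ≥0) (t : ℝ), T.op r (g t) = g (t + r)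
  tails : HasUniformTails g

theorem isBilateralOrbit_zero (T : C0Semigroup X) : T.IsBilateralOrbit fun _ => 0 where
  continuous := continuous_const
  map_op r t := map_zero _
  tails ε hε := ⟨1, one_pos, fun u A B _ _ _ _ => by simpa using hε.le⟩

end C0Semigroup

/-- The semigroup acts on superpositions of bilateral orbits by translating the densities. -/
theorem IsSuperposition.map_op [CompleteSpace X] {T : C0Semigroup X} {g : ℕ → ℝ → X}
    (hg : ∀ i, T.IsBilateralOrbit (g i)) {n : ℕ} {u : ℕ → ℝ → ℂ} {y : X}
    (hu : ∀ i, Measurable (u i)) {C : ℝ} (hC : ∀ i t, ‖u i t‖ ≤ C)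
    (hy : IsSuperposition g n u y) (r : ℝ≥0) :
    IsSuperposition g n (fun i t => u i (t - r)) (T.op r y) := by
  have hshift : Tendsto (fun p : ℝ × ℝ => (p.1 - (r : ℝ), p.2 - (r : ℝ))) (atBot ×ˢ atTop)
      (atBot ×ˢ atTop) :=
    (tendsto_atBot_add_const_right _ _ tendsto_id).prodMap
      (tendsto_atTop_add_const_right _ _ tendsto_id)
  refine (((T.op r).continuous.tendsto y).comp (Tendsto.comp hy hshift)).congr fun p => ?_
  simp only [Function.comp_apply]
  rw [← ContinuousLinearMap.intervalIntegral_comp_comm _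
    (intervalIntegrable_sum_bounded_smul (fun i => (hg i).continuous) hu hC n _ _),
    ← intervalIntegral.integral_comp_sub_right _ (r : ℝ)]
  simp only [map_sum, map_smul, (hg _).map_op, sub_add_cancel]

end

/-! ### Periodic gluing of densities -/

/-- Densities `u 1, …, u s` are glued to one density of period `2 * N + b s` which agrees with `u r` on
the window `(-b r - N, -a r + N]`. The gaps between the `[a r, b r]` are at least `2 * N`, so the
windows are disjoint, and they all lie in the period `(-b s - N, N]`. -/
theorem exists_periodic_glue {s : ℕ} (hs : 1 ≤ s) {a b : ℕ → ℝ} {N C : ℝ} (hN : 0 < N)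
    (ha1 : a 1 = 0) (hab : ∀ r ∈ Icc 1 s, a r ≤ b r)
    (hgap : ∀ r ∈ Ico 1 s, b r + 2 * N ≤ a (r + 1)) {u : ℕ → ℝ → ℂ}
    (hu : ∀ r ∈ Icc 1 s, Measurable (u r)) (hC0 : 0 ≤ C) (hC : ∀ r ∈ Icc 1 s, ∀ t, ‖u r t‖ ≤ C) :
    ∃ v : ℝ → ℂ, Measurable v ∧ (∀ t, ‖v t‖ ≤ C) ∧ (∀ t, v (t - (2 * N + b s)) = v t) ∧
      ∀ r ∈ Icc 1 s, ∀ t ∈ Ioc (-b r - N) (-a r + N), v t = u r t := by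
  have hlt : ∀ q ∈ Icc 1 s, ∀ r ∈ Icc 1 s, q < r → b q + 2 * N ≤ a r := by
    intro q hq r hr hqr
    induction r, Nat.succ_le_of_lt hqr using Nat.le_induction with
    | base => exact hgap q ⟨hq.1, hr.2⟩
    | succ r hqr' ih =>
      have hr' : r ∈ Icc 1 s := ⟨by have := hq.1; omega, by have := hr.2; omega⟩
      have h1 := ih hr' hqr'
      have h2 := hab r hr'
      have h3 := hgap r ⟨hr'.1, hr.2⟩
      linarith
  have ha0 : ∀ r ∈ Icc 1 s, 0 ≤ a r := by
    intro r hr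
    rcases hr.1.eq_or_lt with rfl | h
    · exact ha1.ge
    · have h1 := hlt 1 ⟨le_rfl, hs⟩ r hr h
      have h2 := hab 1 ⟨le_rfl, hs⟩
      linarith
  have hbs : ∀ r ∈ Icc 1 s, b r ≤ b s := by
    intro r hr
    rcases hr.2.eq_or_lt with rfl | h
    · exact le_rfl
    · have h1 := hlt r hr s ⟨hs, le_rfl⟩ h
      have h2 := hab s ⟨hs, le_rfl⟩
      linarith
  have hP : 0 < 2 * N + b s := by
    have h1 := ha0 s ⟨hs, le_rfl⟩
    have h2 := hab s ⟨hs, le_rfl⟩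
    linarith
  let J : ℕ → Set ℝ := fun r => Ioc (-b r - N) (-a r + N)
  have hdisj : ∀ q ∈ Icc 1 s, ∀ r ∈ Icc 1 s, ∀ t ∈ J q, t ∈ J r → q = r := by
    intro q hq r hr t htq htr
    by_contra hne
    rcases lt_or_gt_of_ne hne with h | h
    · linarith [hlt q hq r hr h, htq.1, htr.2]
    · linarith [hlt r hr q hq h, htq.2, htr.1]
  let w : ℝ → ℂ := fun t => ∑ r ∈ Finset.Icc 1 s, (J r).indicator (u r) t
  have hwJ : ∀ r ∈ Icc 1 s, ∀ t ∈ J r, w t = u r t := by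
    intro r hr t ht
    have h : w t = (J r).indicator (u r) t :=
      Finset.sum_eq_single_of_mem r (Finset.mem_Icc.2 hr) fun q hq hqr =>
        indicator_of_notMem (fun htq => hqr (hdisj q (Finset.mem_Icc.1 hq) r hr t htq ht)) _
    rw [h, indicator_of_mem ht]
  have hwC : ∀ t, ‖w t‖ ≤ C := by
    intro t
    by_cases h : ∃ r ∈ Icc 1 s, t ∈ J r
    · obtain ⟨r, hr, ht⟩ := h
      rw [hwJ r hr t ht]
      exact hC r hr t
    · push Not at h
      have h0 : w t = 0 := Finset.sum_eq_zero fun r hr =>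
        indicator_of_notMem (h r (Finset.mem_Icc.1 hr)) _
      rwa [h0, norm_zero]
  have hw : Measurable w := Finset.measurable_fun_sum _ fun r hr =>
    (hu r (Finset.mem_Icc.1 hr)).indicator measurableSet_Ioc
  have hmod : Measurable (toIocMod hP (-b s - N)) := by
    have h : toIocMod hP (-b s - N) = fun t => -b s - N + (2 * N + b s)
        - Int.fract ((-b s - N + (2 * N + b s) - t) / (2 * N + b s)) * (2 * N + b s) := by
      funext t
      exact toIocMod_eq_sub_fract_mul hP _ t
    rw [h]
    fun_prop
  refine ⟨fun t => w (toIocMod hP (-b s - N) t), hw.comp hmod, fun t => hwC _, fun t => ?_,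
    fun r hr t ht => ?_⟩
  · dsimp only
    rw [toIocMod_sub]
  · dsimp only
    rw [(toIocMod_eq_self hP).2, hwJ r hr t ht]
    constructor
    · linarith [ht.1, hbs r hr]
    · linarith [ht.2, ha0 r hr]

/-! ### Specification on sets of superpositions -/

section

variable {X : Type*} [NormedAddCommGroup X] [NormedSpace ℂ X]

/-- The set of all superpositions of `g 0, …, g (n - 1)` with measurable densities bounded by `n`. -/
def superpositions (g : ℕ → ℝ → X) (n : ℕ) : Set X :=
  {y | ∃ u : ℕ → ℝ → ℂ, (∀ i, Measurable (u i)) ∧ (∀ i t, ‖u i t‖ ≤ n) ∧ IsSuperposition g n u y}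

theorem zero_mem_superpositions (g : ℕ → ℝ → X) (n : ℕ) : 0 ∈ superpositions g n :=
  ⟨fun _ _ => 0, fun _ => measurable_const, fun _ _ => by simp, by
    simp [IsSuperposition]⟩

theorem monotone_superpositions (g : ℕ → ℝ → X) : Monotone (superpositions g) := by
  rintro n m hnm y ⟨u, hu, hun, hy⟩
  refine ⟨fun i t => if i < n then u i t else 0, fun i => ?_, fun i t => ?_, ?_⟩
  · dsimp only
    split_ifs
    exacts [hu i, measurable_const]
  · dsimp only
    split_ifs
    · exact (hun i t).trans (Nat.cast_le.2 hnm)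
    · simp
  · refine Tendsto.congr (fun p => ?_) hy
    congr 1
    funext t
    rw [← Finset.sum_subset (Finset.range_subset_range.2 hnm)]
    · refine Finset.sum_congr rfl fun i hi => ?_
      dsimp only
      rw [if_pos (Finset.mem_range.1 hi)]
    · intro i _ hi
      dsimp only
      rw [if_neg (fun h => hi (Finset.mem_range.2 h)), zero_smul]

/-- Means over `[0, h]` of finite linear combinations of the `g i` are superpositions. -/
theorem average_mem_superpositions (g : ℕ → ℝ → X) (c : ℕ →₀ ℂ) {h : ℝ} (hh : 0 < h) :
    ∃ n, h⁻¹ • (∫ t in (0 : ℝ)..h, c.sum fun i z => z • g i t) ∈ superpositions g n := by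
  obtain ⟨m, hm⟩ : ∃ m, c.support ⊆ Finset.range m := Finset.exists_nat_subset_range _
  obtain ⟨k, hk⟩ := exists_nat_ge (h⁻¹ * ∑ i ∈ c.support, ‖c i‖)
  have hck : ∀ i, h⁻¹ * ‖c i‖ ≤ k := fun i => by
    refine le_trans (mul_le_mul_of_nonneg_left ?_ (inv_nonneg.2 hh.le)) hk
    by_cases hi : i ∈ c.support
    · exact Finset.single_le_sum (f := fun i => ‖c i‖) (fun _ _ => norm_nonneg _) hi
    · rw [Finsupp.notMem_support_iff.1 hi, norm_zero]
      exact Finset.sum_nonneg fun _ _ => norm_nonneg _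
  refine ⟨max m k, fun i => (Ioc 0 h).indicator fun _ => (h⁻¹ : ℂ) * c i,
    fun i => measurable_const.indicator measurableSet_Ioc, fun i t => ?_, ?_⟩
  · refine (norm_indicator_le_norm_self _ _).trans ?_
    rw [norm_mul, norm_inv, Complex.norm_real, Real.norm_of_nonneg hh.le]
    exact (hck i).trans (Nat.cast_le.2 (le_max_right _ _))
  · refine tendsto_const_nhds.congr' ?_
    filter_upwards [prod_mem_prod (Iic_mem_atBot (0 : ℝ)) (Ici_mem_atTop h)] with p hp
    have h1 : ∀ t, ∑ i ∈ Finset.range (max m k),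
        (Ioc 0 h).indicator (fun _ => (h⁻¹ : ℂ) * c i) t • g i t
        = (Ioc 0 h).indicator (fun t => (h⁻¹ : ℝ) • c.sum fun i z => z • g i t) t := by
      intro t
      by_cases ht : t ∈ Ioc 0 h
      · simp only [indicator_of_mem ht]
        rw [Finsupp.sum_of_support_subset c (hm.trans (Finset.range_subset_range.2
          (le_max_left m k))) (fun i z => z • g i t) fun _ _ => zero_smul _ _, Finset.smul_sum]
        refine Finset.sum_congr rfl fun i _ => ?_
        rw [mul_smul, ← Complex.ofReal_inv, Complex.coe_smul]
      · simp [indicator_of_notMem ht]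
    have hsub : Ioc 0 h ⊆ Ioc p.1 p.2 := Ioc_subset_Ioc hp.1 hp.2
    simp only [h1]
    rw [intervalIntegral.integral_of_le (hp.1.trans (hh.le.trans hp.2)),
      setIntegral_indicator measurableSet_Ioc, inter_eq_self_of_subset_right hsub,
      integral_smul, intervalIntegral.integral_of_le hh.le]

/-- The mean of `∑ c i • g i` over `[0, h]` tends to `∑ c i • g i 0` as `h → 0`. -/
theorem closure_iUnion_superpositions [CompleteSpace X] {g : ℕ → ℝ → X}
    (hg : ∀ i, Continuous (g i))
    (hd : Dense (Submodule.span ℂ (range fun i => g i 0) : Set X)) :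
    closure (⋃ n, superpositions g n) = univ := by
  have hsub : (Submodule.span ℂ (range fun i => g i 0) : Set X)
      ⊆ closure (⋃ n, superpositions g n) := by
    intro x hx
    obtain ⟨c, rfl⟩ := Finsupp.mem_span_range_iff_exists_finsupp.1 hx
    have hc : Continuous fun t => c.sum fun i z => z • g i t :=
      continuous_finsetSum _ fun i _ => (hg i).const_smul (c i)
    have hderiv := (intervalIntegral.integral_hasDerivAt_right (hc.intervalIntegrable 0 0)
      (hc.stronglyMeasurableAtFilter _ _) hc.continuousAt).tendsto_slope_zero_right
    refine mem_closure_of_tendsto hderiv ?_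
    filter_upwards [self_mem_nhdsWithin] with h hh
    obtain ⟨n, hn⟩ := average_mem_superpositions g c hh
    refine mem_iUnion.2 ⟨n, ?_⟩
    simpa using hn
  exact (hd.mono hsub).closure_eq ▸ closure_closure.symm

namespace C0Semigroup

variable [CompleteSpace X] {T : C0Semigroup X} {g : ℕ → ℝ → X}

theorem mapsTo_superpositions (hg : ∀ i, T.IsBilateralOrbit (g i)) (n : ℕ) (t : ℝ≥0) :
    MapsTo (T.op t) (superpositions g n) (superpositions g n) := by
  rintro y ⟨u, hu, hun, hy⟩
  exact ⟨_, fun i => (hu i).comp (measurable_id.sub_const _), fun i _ => hun i _,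
    hy.map_op hg hu hun t⟩

/-- The specification property on one set `superpositions g n`. With `M = 2 * N`, the tracing point is
the superposition whose densities are glued from those of the `y r`. At a time `t ∈ [a r, b r]` the
densities of `T.op t x` and `T.op t (y r)` agree on `(-N, N]`, so the two points differ by tails;
and the density of `x` has period `M + b s`, so `T.op (M + b s)` fixes `x`. -/
theorem exists_specification (hg : ∀ i, T.IsBilateralOrbit (g i)) (n : ℕ) {δ : ℝ} (hδ : 0 < δ) :
    ∃ M : ℝ≥0, 0 < M ∧ ∀ (s : ℕ), 1 ≤ s → ∀ (y : ℕ → X) (a b : ℕ → ℝ≥0),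
      (∀ r ∈ Icc 1 s, y r ∈ superpositions g n) → a 1 = 0 → (∀ r ∈ Icc 1 s, a r ≤ b r) →
      (∀ r ∈ Ico 1 s, b r + M ≤ a (r + 1)) →
      ∃ x ∈ superpositions g n,
        (∀ r ∈ Icc 1 s, ∀ t ∈ Icc (a r) (b r), ‖T.op t x - T.op t (y r)‖ < δ) ∧
        T.op (M + b s) x = x := by
  have hgc := fun i => (hg i).continuous
  obtain ⟨N, hN0, hN⟩ := HasUniformTails.exists_norm_integral_sum_le hgc (fun i => (hg i).tails) n
    (show (0 : ℝ) ≤ n + n by positivity) (show 0 < δ / 3 by positivity)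
  obtain ⟨M, hM⟩ : ∃ M : ℝ≥0, (M : ℝ) = 2 * N := ⟨⟨2 * N, by positivity⟩, rfl⟩
  refine ⟨M, NNReal.coe_pos.1 (by rw [hM]; positivity), fun s hs y a b hy ha1 hab hgap => ?_⟩
  choose! u hu hun hyu using hy
  choose v hv hvn hvper hvu using fun i => exists_periodic_glue hs (a := fun r => (a r : ℝ))
    (b := fun r => (b r : ℝ)) (u := fun r => u r i) hN0 (by simp [ha1])
    (fun r hr => NNReal.coe_le_coe.2 (hab r hr)) (fun r hr => by
      have := NNReal.coe_le_coe.2 (hgap r hr)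
      rwa [NNReal.coe_add, hM] at this) (fun r hr => hu r hr i) (Nat.cast_nonneg n)
    (fun r hr t => hun r hr i t)
  obtain ⟨x, hx⟩ := exists_isSuperposition hgc (fun i => (hg i).tails) n hv hvn
  refine ⟨x, ⟨v, hv, hvn, hx⟩, fun r hr t ht => ?_, ?_⟩
  · have hdiff := (hx.map_op hg hv hvn t).sub hgc
      (fun i => (hv i).comp (measurable_id.sub_const _))
      (fun i => (hu r hr i).comp (measurable_id.sub_const _)) (fun i _ => hvn i _)
      (fun i _ => hun r hr i _) ((hyu r hr).map_op hg (hu r hr) (hun r hr) t)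
    have hm : ∀ i, Measurable fun τ : ℝ => v i (τ - t) - u r i (τ - t) := fun i =>
      ((hv i).comp (measurable_id.sub_const _)).sub ((hu r hr i).comp (measurable_id.sub_const _))
    have hb : ∀ i (τ : ℝ), ‖v i (τ - t) - u r i (τ - t)‖ ≤ n + n := fun i τ =>
      (norm_sub_le _ _).trans (add_le_add (hvn i _) (hun r hr i _))
    have hle := hdiff.norm_le hgc hm hb hN0 (fun A B hAB => hN _ A B hm hb hAB)
      fun i τ hτ => sub_eq_zero.2 (hvu i r hr (τ - t) ⟨by
        have := NNReal.coe_le_coe.2 ht.2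
        linarith [hτ.1], by
        have := NNReal.coe_le_coe.2 ht.1
        linarith [hτ.2]⟩)
    linarith
  · refine tendsto_nhds_unique (hx.map_op hg hv hvn _) ?_
    refine hx.congr fun p => ?_
    simp only [NNReal.coe_add, hM, hvper]

theorem hasSgSP_of_dense_span_bilateralOrbits (hg : ∀ i, T.IsBilateralOrbit (g i))
    (hd : Dense (Submodule.span ℂ (range fun i => g i 0) : Set X)) : T.HasSgSP := by
  refine ⟨superpositions g, monotone_superpositions g, mapsTo_superpositions hg,
    zero_mem_superpositions g 0, closure_iUnion_superpositions (fun i => (hg i).continuous) hd,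
    1, one_pos, fun n δ hδ => ?_⟩
  obtain ⟨M, hM0, hM⟩ := exists_specification hg n hδ
  exact ⟨M, hM0, fun s hs y a b hy ha1 hab _ _ hgap =>
    hM s (one_le_two.trans hs) y a b hy ha1 hab hgap⟩

end C0Semigroup

end

/-! ### Wave packets of eigenvectors -/

section

variable {X : Type*} [NormedAddCommGroup X] [NormedSpace ℂ X]

/-- An eigenvector of the generator is an eigenvector of the semigroup: `exp (-t * c) • T_t x` is
continuous with right derivative `0`. -/
theorem C0Semigroup.op_eq_exp_smul {T : C0Semigroup X} {x : X} {c : ℂ}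
    (h : T.HasGeneratorValue x (c • x)) (r : ℝ≥0) : T.op r x = Complex.exp (r * c) • x := by
  let w : ℝ → X := fun t => T.op t.toNNReal x
  have hwc : Continuous w :=
    (continuous_iff_continuousAt.2 fun s => T.tendsto_op x s).comp continuous_real_toNNReal
  have hw : ∀ t ∈ Ico (0 : ℝ) r, HasDerivWithinAt w (c • w t) (Ici t) t := by
    intro t ht
    rw [← hasDerivWithinAt_Ioi_iff_Ici, hasDerivWithinAt_iff_tendsto_slope' self_notMem_Ioi]
    have hsub : Tendsto (fun τ : ℝ => (τ - t).toNNReal) (𝓝[>] t) (𝓝[>] 0) := by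
      refine tendsto_nhdsWithin_iff.2 ⟨?_, ?_⟩
      · have h1 : Continuous fun τ : ℝ => (τ - t).toNNReal :=
          continuous_real_toNNReal.comp (continuous_sub_right t)
        have h2 := h1.tendsto t
        rw [sub_self, Real.toNNReal_zero] at h2
        exact h2.mono_left nhdsWithin_le_nhds
      · filter_upwards [self_mem_nhdsWithin] with τ hτ
        exact Real.toNNReal_pos.2 (sub_pos.2 hτ)
    have h3 := ((T.op t.toNNReal).continuous.tendsto _).comp (h.comp hsub)
    rw [map_smul] at h3
    refine h3.congr' ?_
    filter_upwards [self_mem_nhdsWithin] with τ hτ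
    have hτ' : 0 ≤ τ - t := (sub_pos.2 hτ).le
    have hadd : τ.toNNReal = t.toNNReal + (τ - t).toNNReal := by
      rw [← Real.toNNReal_add ht.1 hτ', add_sub_cancel]
    simp only [Function.comp_apply, slope, vsub_eq_sub, w]
    rw [hadd, T.op_add, map_smul, map_sub, Real.coe_toNNReal _ hτ', ← Complex.ofReal_inv,
      Complex.coe_smul, ContinuousLinearMap.comp_apply]
  have hexp : ∀ t : ℝ, HasDerivAt (fun t : ℝ => Complex.exp (-(t * c)))
      (Complex.exp (-(t * c)) * -c) t := by
    intro t
    have h1 : HasDerivAt (fun t : ℝ => -((t : ℂ) * c)) (-c) t := by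
      simpa using ((hasDerivAt_id t).ofReal_comp.mul_const c).fun_neg
    exact h1.cexp
  have hconst := constant_of_has_deriv_right_zero (a := 0) (b := r)
    (f := fun t : ℝ => Complex.exp (-(t * c)) • w t)
    (Continuous.continuousOn (by fun_prop)) (fun t ht => by
      have h1 := (hexp t).hasDerivWithinAt.smul (hw t ht)
      refine h1.congr_deriv ?_
      rw [smul_smul, ← add_smul]
      simp) r (right_mem_Icc.2 r.2)
  simp only [w, Real.toNNReal_coe, Real.toNNReal_zero, T.op_zero, Complex.ofReal_zero, zero_mul,
    neg_zero, Complex.exp_zero, one_smul, ContinuousLinearMap.id_apply] at hconst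
  calc T.op r x = Complex.exp (r * c) • Complex.exp (-(r * c)) • T.op r x := by
        rw [smul_smul, ← Complex.exp_add, add_neg_cancel, Complex.exp_zero, one_smul]
    _ = Complex.exp (r * c) • x := congrArg _ hconst

theorem IsCompact.exists_norm_le_of_locally_bounded {E : Type*} [NormedAddCommGroup E] {f : ℝ → E}
    {I K : Set ℝ} (hK : IsCompact K)
    (hKI : K ⊆ I) (hf : ∀ t ∈ I, ∃ C : ℝ, ∀ᶠ s in 𝓝[I] t, ‖f s‖ ≤ C) :
    ∃ C : ℝ, ∀ s ∈ K, ‖f s‖ ≤ C := by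
  refine hK.induction_on (p := fun S => ∃ C : ℝ, ∀ s ∈ S, ‖f s‖ ≤ C) ⟨0, by simp⟩
    (fun S S' hS ⟨C, hC⟩ => ⟨C, fun s hs => hC s (hS hs)⟩)
    (fun S S' ⟨C, hC⟩ ⟨C', hC'⟩ => ⟨max C C', fun s hs => hs.elim
      (fun h => (hC s h).trans (le_max_left _ _)) fun h => (hC' s h).trans (le_max_right _ _)⟩)
    fun t ht => ?_
  obtain ⟨C, hC⟩ := hf t (hKI ht)
  exact ⟨_, nhdsWithin_mono t hKI hC, C, fun s hs => hs⟩

theorem integrable_smul_of_locally_bounded {f : ℝ → X} {I : Set ℝ} (hI : I.OrdConnected)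
    (hfm : StronglyMeasurable (I.domRestrict f))
    (hf : ∀ t ∈ I, ∃ C : ℝ, ∀ᶠ s in 𝓝[I] t, ‖f s‖ ≤ C) {φ : ℝ → ℝ} (hφ : Continuous φ)
    (hφc : HasCompactSupport φ) (hφI : tsupport φ ⊆ I) : Integrable fun t => φ t • f t := by
  -- `f` is measurable on `I` only, so it is replaced by a globally measurable extension
  obtain ⟨f', hf'm, hf'⟩ := (MeasurableEmbedding.subtype_coe
    hI.measurableSet).exists_stronglyMeasurable_extend hfm fun _ => ⟨0⟩
  have heq : ∀ t ∈ I, f' t = f t := fun t ht => congrFun hf' ⟨t, ht⟩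
  have hfun : (fun t => φ t • f t) = fun t => φ t • f' t := by
    funext t
    by_cases ht : t ∈ I
    · rw [heq t ht]
    · rw [image_eq_zero_of_notMem_tsupport fun h => ht (hφI h), zero_smul, zero_smul]
  obtain ⟨C, hC⟩ := hφc.isCompact.exists_norm_le_of_locally_bounded hφI hf
  obtain ⟨D, hD⟩ := hφc.exists_bound_of_continuous hφ
  rw [hfun, ← integrableOn_iff_integrable_of_support_subset (s := tsupport φ)]
  · refine IntegrableOn.of_bound hφc.isCompact.measure_lt_top
      (hφ.stronglyMeasurable.smul hf'm).aestronglyMeasurable (D * C) ?_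
    filter_upwards [ae_restrict_mem hφc.isCompact.measurableSet] with t ht
    rw [norm_smul, heq t (hφI ht)]
    exact mul_le_mul (hD t) (hC t ht) (norm_nonneg _) ((norm_nonneg _).trans (hD t))
  · intro t ht
    by_contra h
    exact ht (by simp [image_eq_zero_of_notMem_tsupport h])

theorem ContDiffOn.contDiff_smul_of_tsupport_subset {E : Type*} [NormedAddCommGroup E]
    [NormedSpace ℝ E] {n : WithTop ℕ∞} {f : ℝ → E} {I : Set ℝ} (hf : ContDiffOn ℝ n f I)
    {φ : ℝ → ℝ} (hφ : ContDiff ℝ n φ) (hφI : tsupport φ ⊆ interior I) :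
    ContDiff ℝ n fun t => φ t • f t := by
  refine contDiff_iff_contDiffAt.2 fun t => ?_
  by_cases ht : t ∈ tsupport φ
  · exact hφ.contDiffAt.smul (hf.contDiffAt (mem_interior_iff_mem_nhds.1 (hφI ht)))
  · refine (contDiffAt_const (c := (0 : E))).congr_of_eventuallyEq ?_
    filter_upwards [notMem_tsupport_iff_eventuallyEq.1 ht] with s hs
    rw [hs, Pi.zero_apply, zero_smul]

/-- The curve `t ↦ ∫ exp (I * t * s) • F s ds`, written as a rescaled Fourier transform. When each `F s`
is an eigenvector of the generator for `I * s`, it is the orbit of `∫ F` extended to all times. -/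
noncomputable def wavePacket (F : ℝ → X) (t : ℝ) : X :=
  𝓕 F (-(2 * Real.pi)⁻¹ * t)

theorem wavePacket_eq_integral (F : ℝ → X) (t : ℝ) :
    wavePacket F t = ∫ s : ℝ, Complex.exp (t * (Complex.I * s)) • F s := by
  rw [wavePacket, Real.fourier_real_eq_integral_exp_smul]
  congr 1
  funext s
  congr 2
  push_cast
  field_simp

theorem continuous_wavePacket {F : ℝ → X} (hF : Integrable F) : Continuous (wavePacket F) := by
  have h : Continuous (𝓕 F) :=
    VectorFourier.fourierIntegral_continuous Real.continuous_fourierChar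
      (by exact continuous_inner) hF
  exact h.comp (continuous_const_mul _)

theorem integrable_exp_smul {F : ℝ → X} (hF : Integrable F) (t : ℝ) :
    Integrable fun s : ℝ => Complex.exp (t * (Complex.I * s)) • F s := by
  refine hF.bdd_smul 1 (Continuous.aestronglyMeasurable (by fun_prop))
    (Eventually.of_forall fun s => ?_)
  rw [mul_left_comm, mul_comm, ← Complex.ofReal_mul, Complex.norm_exp_ofReal_mul_I]

theorem map_wavePacket [CompleteSpace X] {F : ℝ → X} (hF : Integrable F) (ψ : X →L[ℂ] ℂ) (t : ℝ) :
    ψ (wavePacket F t) = wavePacket (fun s => ψ (F s)) t := by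
  rw [wavePacket_eq_integral, wavePacket_eq_integral,
    ← ψ.integral_comp_comm (integrable_exp_smul hF t)]
  simp only [map_smul]

theorem integrable_wavePacket {F : ℝ → X} (hF : Integrable (𝓕 F)) : Integrable (wavePacket F) :=
  hF.comp_mul_left' (neg_ne_zero.2 (inv_ne_zero Real.two_pi_pos.ne'))

theorem C0Semigroup.op_wavePacket [CompleteSpace X] {T : C0Semigroup X} {F : ℝ → X}
    (hF : Integrable F) (heig : ∀ s : ℝ, T.HasGeneratorValue (F s) ((Complex.I * s) • F s))
    (r : ℝ≥0) (t : ℝ) : T.op r (wavePacket F t) = wavePacket F (t + r) := by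
  rw [wavePacket_eq_integral, wavePacket_eq_integral,
    ← (T.op r).integral_comp_comm (integrable_exp_smul hF t)]
  congr 1
  funext s
  rw [map_smul, C0Semigroup.op_eq_exp_smul (heig s), smul_smul, ← Complex.exp_add]
  congr 2
  push_cast
  ring

theorem Submodule.exists_dual_ne_zero_of_notMem_closed {W : Submodule ℂ X}
    (hW : IsClosed (W : Set X)) {x : X} (hx : x ∉ W) :
    ∃ ψ : X →L[ℂ] ℂ, ψ x ≠ 0 ∧ ∀ w ∈ W, ψ w = 0 := by
  have hconv : Convex ℝ (W : Set X) := (W.restrictScalars ℝ).convex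
  obtain ⟨ψ, u, hu, hx'⟩ := RCLike.geometric_hahn_banach_closed_point (𝕜 := ℂ) hconv hW hx
  refine ⟨ψ, fun h => ?_, fun w hw => ?_⟩
  · have h0 := hu 0 W.zero_mem
    rw [map_zero, map_zero] at h0
    rw [h, map_zero] at hx'
    exact lt_asymm h0 hx'
  · by_contra h
    -- a multiple of `w` on which `ψ` takes the value `u + 1` exceeds the bound `u` on `W`
    have h1 := hu _ (W.smul_mem (((u + 1 : ℝ) : ℂ) / ψ w) hw)
    rw [map_smul, smul_eq_mul, div_mul_cancel₀ _ h] at h1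
    simp at h1
    linarith

/-- A closed subspace that contains the integrals of a weakly continuous `f` against all test functions
supported in the interior of an interval contains the values of `f` on the whole interval, including
endpoints that belong to it. -/
theorem mem_of_integral_contDiff_smul_mem [CompleteSpace X] {W : Submodule ℂ X}
    (hW : IsClosed (W : Set X)) {f : ℝ → X} {I : Set ℝ} (hI : I.OrdConnected) (hI' : I.Nontrivial)
    (hf : ∀ ψ : X →L[ℂ] ℂ, ContinuousOn (fun t => ψ (f t)) I)
    (hint : ∀ φ : ℝ → ℝ, ContDiff ℝ ((⊤ : ℕ∞) : WithTop ℕ∞) φ → HasCompactSupport φ →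
      tsupport φ ⊆ interior I → Integrable (fun t => φ t • f t) ∧ ∫ t, φ t • f t ∈ W)
    {t : ℝ} (ht : t ∈ I) : f t ∈ W := by
  by_contra hx
  obtain ⟨ψ, hψ, hψW⟩ := W.exists_dual_ne_zero_of_notMem_closed hW hx
  refine hψ ?_
  have hci := (hf ψ).mono interior_subset
  have hae := isOpen_interior.ae_eq_zero_of_integral_contDiff_smul_eq_zero (μ := volume)
    (hci.locallyIntegrableOn isOpen_interior.measurableSet) fun φ hφ hφc hφI => by
      obtain ⟨h1, h2⟩ := hint φ hφ hφc hφI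
      rw [← hψW _ h2, ← ψ.integral_comp_comm h1]
      congr 1
      funext s
      rw [← Complex.coe_smul, ← Complex.coe_smul, map_smul]
  have hzero : EqOn (fun t => ψ (f t)) 0 (interior I) := by
    refine Measure.eqOn_open_of_ae_eq (μ := volume) ?_ isOpen_interior hci continuousOn_const
    rw [Filter.EventuallyEq, ae_restrict_iff' isOpen_interior.measurableSet]
    exact hae
  have hconv : Convex ℝ I := convex_iff_ordConnected.2 hI
  have hcl : I ⊆ closure (interior I) := by
    rw [hconv.closure_interior_eq_closure_of_nonempty_interior
      (hconv.nontrivial_iff_nonempty_interior.1 hI')]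
    exact subset_closure
  exact hzero.of_subset_closure (hf ψ) continuousOn_const interior_subset hcl ht

end

/-! ### Specification from regular families of eigenvectors -/

theorem exists_seq_dense_span {X : Type*} [NormedAddCommGroup X] [NormedSpace ℂ X]
    [TopologicalSpace.SeparableSpace X] {Y : Set X} (hY : Y.Nonempty)
    (hd : Dense (Submodule.span ℂ Y : Set X)) :
    ∃ x : ℕ → X, (∀ i, x i ∈ Y) ∧ Dense (Submodule.span ℂ (range x) : Set X) := by
  have := UniformSpace.secondCountable_of_separable X
  have : Nonempty Y := hY.to_subtype
  refine ⟨fun i => TopologicalSpace.denseSeq Y i, fun i => Subtype.coe_prop _, ?_⟩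
  have hYcl : Y ⊆ closure (range fun i => (TopologicalSpace.denseSeq Y i : X)) := by
    intro y hy
    have h := mem_closure_image (f := ((↑) : Y → X)) continuous_subtype_val.continuousAt
      (TopologicalSpace.denseRange_denseSeq Y ⟨y, hy⟩)
    rwa [← range_comp] at h
  have hspan : Submodule.span ℂ Y ≤ (Submodule.span ℂ
      (range fun i => (TopologicalSpace.denseSeq Y i : X))).topologicalClosure :=
    Submodule.span_le.2 (hYcl.trans (closure_mono Submodule.subset_span))
  exact dense_closure.1 (hd.mono hspan)

theorem mainTheorem4 {X : Type*} [NormedAddCommGroup X] [NormedSpace ℂ X] [CompleteSpace X]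
    [TopologicalSpace.SeparableSpace X] (T : C0Semigroup X)
    {Γ : Type*} (I : Γ → Set ℝ) (f : Γ → ℝ → X)
    (hI : ∀ j, (I j).OrdConnected ∧ (I j).Nontrivial)
    (hf_meas : ∀ j, MeasureTheory.StronglyMeasurable ((I j).domRestrict (f j)))
    (hf_bdd : ∀ j, ∀ t ∈ I j, ∃ C : ℝ, ∀ᶠ s in 𝓝[I j] t, ‖f j s‖ ≤ C)
    (hf_eig : ∀ j, ∀ t ∈ I j, ∃ h : f j t ∈ T.generator.domain,
      T.generator ⟨f j t, h⟩ = (Complex.I * (t : ℂ)) • f j t)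
    (hf_span : Dense (Submodule.span ℂ {x : X | ∃ j, ∃ t ∈ I j, f j t = x} : Set X))
    (hf_reg : (∀ j, ContDiffOn ℝ 2 (f j) (I j)) ∨
      (¬ ContainsC0 X ∧
        ∀ (φ : X →L[ℂ] ℂ) (j : Γ), ContDiffOn ℝ 1 (fun t => φ (f j t)) (I j))) :
    T.HasSgSP := by
  -- the orbit of a wave packet of `f j` is bilateral, with small tails by the regularity of `f j`
  have hpacket : ∀ (j : Γ) (φ : ℝ → ℝ), ContDiff ℝ ((⊤ : ℕ∞) : WithTop ℕ∞) φ →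
      HasCompactSupport φ → tsupport φ ⊆ interior (I j) →
      Integrable (fun t => φ t • f j t) ∧ T.IsBilateralOrbit (wavePacket fun t => φ t • f j t) := by
    intro j φ hφ hφc hφI
    have hF : Integrable fun t => φ t • f j t := integrable_smul_of_locally_bounded (hI j).1
      (hf_meas j) (hf_bdd j) hφ.continuous hφc (hφI.trans interior_subset)
    refine ⟨hF, continuous_wavePacket hF, T.op_wavePacket hF fun s => ?_, ?_⟩
    · by_cases hs : s ∈ I j
      · obtain ⟨h, hgen⟩ := hf_eig j s hs
        have h1 := T.hasGeneratorValue_generator ⟨f j s, h⟩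
        rw [hgen] at h1
        have h2 := h1.smul (φ s : ℂ)
        rwa [smul_comm, Complex.coe_smul] at h2
      · rw [image_eq_zero_of_notMem_tsupport fun h => hs (interior_subset (hφI h)), zero_smul,
          smul_zero]
        exact T.hasGeneratorValue_zero
    · rcases hf_reg with hreg | ⟨hX, hreg⟩
      · exact .of_integrable (continuous_wavePacket hF) (integrable_wavePacket
          (integrable_fourier_of_contDiff_two ((hreg j).contDiff_smul_of_tsupport_subset
            (contDiff_infty.1 hφ 2) hφI) hφc.smul_right))
      · refine .of_dual_integrable hX (continuous_wavePacket hF) fun ψ => ?_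
        have hψ : (fun t => ψ (wavePacket (fun t => φ t • f j t) t))
            = wavePacket fun t => φ t • ψ (f j t) := by
          funext t
          rw [map_wavePacket hF]
          congr 1
          funext s
          rw [← Complex.coe_smul, ← Complex.coe_smul, map_smul]
        rw [hψ]
        exact integrable_wavePacket (integrable_fourier_of_contDiff_one
          ((hreg ψ j).contDiff_smul_of_tsupport_subset
            (mod_cast contDiff_infty.1 hφ 1) hφI) hφc.smul_right)
  have hcont : ∀ (ψ : X →L[ℂ] ℂ) (j : Γ), ContinuousOn (fun t => ψ (f j t)) (I j) := by
    intro ψ j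
    rcases hf_reg with hreg | ⟨-, hreg⟩
    · exact ψ.continuous.comp_continuousOn (hreg j).continuousOn
    · exact (hreg ψ j).continuousOn
  let Y : Set X := {x | ∃ g, T.IsBilateralOrbit g ∧ g 0 = x}
  have hle : Submodule.span ℂ {x : X | ∃ j, ∃ t ∈ I j, f j t = x}
      ≤ (Submodule.span ℂ Y).topologicalClosure := by
    rw [Submodule.span_le]
    rintro _ ⟨j, t, ht, rfl⟩
    refine mem_of_integral_contDiff_smul_mem (Submodule.isClosed_topologicalClosure _)
      (hI j).1 (hI j).2 (fun ψ => hcont ψ j) (fun φ hφ hφc hφI => ?_) ht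
    obtain ⟨h1, h2⟩ := hpacket j φ hφ hφc hφI
    refine ⟨h1, Submodule.le_topologicalClosure _ (Submodule.subset_span ⟨_, h2, ?_⟩)⟩
    rw [wavePacket_eq_integral]
    simp
  obtain ⟨x, hxY, hxd⟩ := exists_seq_dense_span (Y := Y)
    ⟨0, _, T.isBilateralOrbit_zero, rfl⟩ (dense_closure.1 (hf_span.mono hle))
  choose g hg hgx using hxY
  refine C0Semigroup.hasSgSP_of_dense_span_bilateralOrbits hg ?_
  simpa only [hgx] using hxd
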